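/- Let $\mathbb{F}$ be a field of characteristic zero and let $\mathfrak{L}$ be a finite-dimensional left Leibniz algebra over $\mathbb{F}$, that is, a finite-dimensional $\mathbb{F}$-vector space with a bilinear multiplication such that $x(yz)=(xy)z+y(xz)$ for all $x,y,z\in\mathfrak{L}$. Suppose that $\mathfrak{L}$ is semi-simple, i.e., the Leibniz kernel $\mathrm{Leib}(\mathfrak{L}):=\langle x^2\mid x\in\mathfrak{L}\rangle_{\mathbb{F}}$ contains every solvable two-sided ideal of $\mathfrak{L}$. Here an ideal $I$ is solvable if $I^{(n)}=0$ for some $n\ge 0$, where $I^{(0)}:=I$ and $I^{(n+1)}:=\langle ab\mid a,b\in I^{(n)}\rangle_{\mathbb{F}}$. Then the right center $$C^r(\mathfrak{L}):=\{c\in\mathfrak{L}\mid xc=0\text{ for all }x\in\mathfrak{L}\}$$ of $\mathfrak{L}$ is zero. -/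

import Mathlib

/-!
An algebra over a field `F`, with no identity assumed on its bilinear multiplication, is a type `L`
with the classes `[NonUnitalNonAssocRing L] [Module F L] [IsScalarTower F L L]
[SMulCommClass F L L]`.
-/

namespace LeibnizAlg

/-- Every left multiplication operator `y ↦ x * y` is a derivation. -/
def IsLeftLeibniz (L : Type*) [NonUnitalNonAssocRing L] : Prop :=
  ∀ x y z : L, x * (y * z) = (x * y) * z + y * (x * z)

section

variable (F : Type*) {L : Type*} [Field F] [NonUnitalNonAssocRing L] [Module F L]

variable (L) in
/-- The Leibniz kernel: the subspace spanned by the squares. -/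
def leibnizKernel : Submodule F L :=
  Submodule.span F {z : L | ∃ x : L, z = x * x}

variable (L) in
/-- The right center: all `c` with `x * c = 0` for every `x`. -/
def rightCenter [SMulCommClass F L L] : Submodule F L where
  carrier := {c : L | ∀ x : L, x * c = 0}
  zero_mem' := fun x => mul_zero x
  add_mem' := by
    intro a b ha hb x
    rw [mul_add, ha x, hb x, add_zero]
  smul_mem' := by
    intro t c hc x
    rw [mul_smul_comm, hc x, smul_zero]

variable {F}

/-- A subspace that is a two-sided ideal. -/
def IsIdeal (I : Submodule F L) : Prop :=
  ∀ x : L, ∀ a ∈ I, x * a ∈ I ∧ a * x ∈ I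

/-- The derived series of a subspace `I`: it starts with `I`, and each further term is the subspace
spanned by the products of two elements of the preceding term. -/
def derivedSeries (I : Submodule F L) : ℕ → Submodule F L
  | 0 => I
  | n + 1 => Submodule.span F
      {z : L | ∃ a ∈ derivedSeries I n, ∃ b ∈ derivedSeries I n, z = a * b}

/-- Solvability: the derived series reaches zero. -/
def IsSolvable (I : Submodule F L) : Prop :=
  ∃ n : ℕ, derivedSeries I n = ⊥

variable (F L) in
/-- Semi-simplicity of a Leibniz algebra: the Leibniz kernel contains every solvable ideal. -/
def IsSemisimple : Prop :=
  ∀ I : Submodule F L, IsIdeal I → IsSolvable I → I ≤ leibnizKernel F L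

end

end LeibnizAlg

/-! The left multiplications of `L` form a Lie algebra acting on `L`, whose invariants are the right
center. Semi-simplicity makes its radical trivial and puts the right center inside the Leibniz
kernel, which lies in the span of the image of the action since `x * x` is the action of left
multiplication by `x` on `x`. So it suffices that invariants meet this span only in zero
(`eq_zero_of_mem_maxTrivSubmodule_of_mem_lie_top`). If the trace form vanishes, the action is
trivial. Otherwise the Fitting decomposition of a Casimir operator confines the vector to a proper
submodule, and induction on dimension applies. -/

namespace LieModule

open Module LinearMap

attribute [local instance] LieRing.ofAssociativeRing

/-! ### Trace forms and Casimir operators -/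

section LieRep

variable {K L : Type*} [Field K] [LieRing L] [LieAlgebra K L]

/-- A finite-dimensional Lie algebra with nondegenerate Killing form is perfect. -/
lemma _root_.LieAlgebra.IsKilling.lie_top_top [FiniteDimensional K L] [LieAlgebra.IsKilling K L] :
    ⁅(⊤ : LieIdeal K L), (⊤ : LieIdeal K L)⁆ = ⊤ := by
  set D : LieIdeal K L := ⁅(⊤ : LieIdeal K L), (⊤ : LieIdeal K L)⁆ with hD
  have hcompl : LieIdeal.killingCompl K L D = ⊥ := by
    rw [eq_bot_iff]
    intro x hx
    have hcenter : x ∈ LieAlgebra.center K L := by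
      rw [mem_maxTrivSubmodule]
      intro y
      have hker : ⁅y, x⁆ ∈ LieIdeal.killingCompl K L ⊤ := by
        rw [LieIdeal.mem_killingCompl]
        intro z _
        rw [← traceForm_apply_lie_apply]
        exact (LieIdeal.mem_killingCompl K L D).mp hx _
          (LieSubmodule.lie_mem_lie (LieSubmodule.mem_top z) (LieSubmodule.mem_top y))
      rwa [LieAlgebra.IsKilling.killingCompl_top_eq_bot, LieSubmodule.mem_bot] at hker
    rwa [LieAlgebra.center_eq_bot] at hcenter
  have h := (LieIdeal.isCompl_killingCompl D).sup_eq_top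
  rwa [hcompl, sup_bot_eq] at h

variable {M : Type*} [AddCommGroup M] [Module K M] [LieRingModule L M] [LieModule K L M]

/-- The Casimir operator attached to a pair of families `b`, `b'` that are dual bases of an ideal
`J` with respect to the trace form commutes with the action. -/
lemma commute_toEnd_sum_mul (J : LieIdeal K L) {ι : Type*} [Fintype ι] (b b' : ι → L)
    (hb : ∀ i, b i ∈ J) (hb' : ∀ i, b' i ∈ J)
    (h : ∀ x ∈ J, x = ∑ i, traceForm K L M x (b' i) • b i)
    (h' : ∀ x ∈ J, x = ∑ i, traceForm K L M x (b i) • b' i) (y : L) :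
    Commute (toEnd K L M y) (∑ i, toEnd K L M (b i) * toEnd K L M (b' i)) := by
  have e (i : ι) : toEnd K L M y * toEnd K L M (b i) = toEnd K L M (b i) * toEnd K L M y +
      ∑ j, traceForm K L M ⁅y, b i⁆ (b' j) • toEnd K L M (b j) := by
    have := congrArg (toEnd K L M) (h _ (J.lie_mem (x := y) (hb i)))
    rw [map_sum] at this
    simp only [map_smul] at this
    rw [← this, LieHom.map_lie, LieRing.of_associative_ring_bracket]
    abel
  have e' (i : ι) : toEnd K L M y * toEnd K L M (b' i) = toEnd K L M (b' i) * toEnd K L M y +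
      ∑ j, traceForm K L M ⁅y, b' i⁆ (b j) • toEnd K L M (b' j) := by
    have := congrArg (toEnd K L M) (h' _ (J.lie_mem (x := y) (hb' i)))
    rw [map_sum] at this
    simp only [map_smul] at this
    rw [← this, LieHom.map_lie, LieRing.of_associative_ring_bracket]
    abel
  -- By invariance the two coefficient matrices of bracketing with `y` are negative transposes, so
  -- the correction terms cancel.
  have hinv (i j : ι) :
      traceForm K L M ⁅y, b' i⁆ (b j) = -traceForm K L M ⁅y, b j⁆ (b' i) := by
    rw [traceForm_lieInvariant K L M y, traceForm_comm]
  have hcancel : ∑ i, ∑ j, traceForm K L M ⁅y, b i⁆ (b' j) •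
        (toEnd K L M (b j) * toEnd K L M (b' i)) +
      ∑ i, ∑ j, traceForm K L M ⁅y, b' i⁆ (b j) •
        (toEnd K L M (b i) * toEnd K L M (b' j)) = 0 := by
    rw [Finset.sum_comm, ← Finset.sum_add_distrib]
    refine Finset.sum_eq_zero fun i _ ↦ ?_
    rw [← Finset.sum_add_distrib]
    refine Finset.sum_eq_zero fun j _ ↦ ?_
    rw [hinv, neg_smul, add_neg_cancel]
  rw [commute_iff_eq, Finset.mul_sum, Finset.sum_mul, ← sub_eq_zero, ← hcancel,
    ← Finset.sum_sub_distrib, ← Finset.sum_add_distrib]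
  refine Finset.sum_congr rfl fun i _ ↦ ?_
  rw [← mul_assoc, e, add_mul, mul_assoc, e', mul_add, Finset.sum_mul, Finset.mul_sum, mul_assoc]
  simp only [smul_mul_assoc, mul_smul_comm]
  abel

variable [CharZero K] [FiniteDimensional K L] [LieAlgebra.HasTrivialRadical K L]

/-- A representation with zero trace form of a semisimple Lie algebra is trivial. -/
lemma lie_top_top_eq_bot_of_traceForm_eq_zero [FiniteDimensional K M] (h : traceForm K L M = 0) :
    ⁅(⊤ : LieIdeal K L), (⊤ : LieSubmodule K L M)⁆ = ⊥ := by
  have hperfect := LieAlgebra.IsKilling.lie_top_top (K := K) (L := L)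
  have hnil : IsNilpotent L M := by
    rw [isNilpotent_iff_forall' (R := K)]
    have h₁ := isNilpotent_derivedSeries_of_traceForm_eq_zero (R := K) h
    rw [isNilpotent_iff_forall' (R := K)] at h₁
    intro x
    refine h₁ ⟨x, ?_⟩
    rw [LieAlgebra.derivedSeries_def, LieAlgebra.derivedSeriesOfIdeal_succ,
      LieAlgebra.derivedSeriesOfIdeal_zero, hperfect]
    exact LieSubmodule.mem_top x
  set N : LieSubmodule K L M := ⁅(⊤ : LieIdeal K L), (⊤ : LieSubmodule K L M)⁆ with hN
  -- Perfectness lets each acting element be a sum of brackets, so `N` sits in every term of the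
  -- lower central series.
  have hstable : N ≤ ⁅(⊤ : LieIdeal K L), N⁆ := by
    conv_lhs => rw [hN, ← hperfect]
    rw [LieSubmodule.lie_le_iff]
    intro x hx m _
    rw [← LieSubmodule.mem_toSubmodule, LieSubmodule.lieIdeal_oper_eq_linear_span'] at hx
    induction hx using Submodule.span_induction with
    | mem x hx =>
      obtain ⟨y, -, z, -, rfl⟩ := hx
      rw [lie_lie]
      exact sub_mem
        (LieSubmodule.lie_mem_lie (LieSubmodule.mem_top y)
          (LieSubmodule.lie_mem_lie (LieSubmodule.mem_top z) (LieSubmodule.mem_top m)))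
        (LieSubmodule.lie_mem_lie (LieSubmodule.mem_top z)
          (LieSubmodule.lie_mem_lie (LieSubmodule.mem_top y) (LieSubmodule.mem_top m)))
    | zero => rw [zero_lie]; exact zero_mem _
    | add x y _ _ hx hy => rw [add_lie]; exact add_mem hx hy
    | smul t x _ hx => rw [smul_lie]; exact SMulMemClass.smul_mem t hx
  have hle (k : ℕ) : N ≤ lowerCentralSeries K L M k := by
    induction k with
    | zero => rw [lowerCentralSeries_zero]; exact le_top
    | succ k ih =>
      rw [lowerCentralSeries_succ]
      exact hstable.trans (LieSubmodule.mono_lie_right _ ih)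
  obtain ⟨k, hk⟩ := (isNilpotent_iff K L M).mp hnil
  exact le_bot_iff.mp (hk ▸ hle k)

variable (K L M) in
/-- If the trace form of a representation of a semisimple Lie algebra is nonzero, some
non-nilpotent endomorphism that kills the invariants commutes with the action. -/
lemma exists_commute_toEnd_not_isNilpotent (h : traceForm K L M ≠ 0) :
    ∃ Ω : End K M, (∀ y : L, Commute (toEnd K L M y) Ω) ∧ ¬ _root_.IsNilpotent Ω ∧
      ∀ m ∈ maxTrivSubmodule K L M, Ω m = 0 := by
  -- `I` is the radical of the trace form, so the form is nondegenerate on the Killing complement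
  -- `J`.
  let I : LieIdeal K L := LieAlgebra.InvariantForm.orthogonal (traceForm K L M)
    (traceForm_lieInvariant K L M) ⊤
  have hI (x : L) : x ∈ I ↔ ∀ y, traceForm K L M y x = 0 := by
    simp [I, LieAlgebra.InvariantForm.mem_orthogonal]
  let J : LieIdeal K L := LieIdeal.killingCompl K L I
  have hIJ : IsCompl I J := LieIdeal.isCompl_killingCompl I
  let B : LinearMap.BilinForm K J.toSubmodule := (traceForm K L M).restrict J.toSubmodule
  have hBsymm : B.IsSymm := ⟨fun x y ↦ traceForm_comm K L M x y⟩
  have hsep : ∀ x : J.toSubmodule, (∀ y, B x y = 0) → x = 0 := by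
    intro x hx
    have hxI : (x : L) ∈ I := by
      rw [hI]
      intro y
      obtain ⟨u, hu, w, hw, rfl⟩ := (LieSubmodule.mem_sup I J y).mp
        (hIJ.sup_eq_top ▸ LieSubmodule.mem_top y)
      have h₁ : traceForm K L M u x = 0 := by rw [traceForm_comm]; exact (hI u).mp hu x
      have h₂ : traceForm K L M w x = 0 := by rw [traceForm_comm]; exact hx ⟨w, hw⟩
      rw [map_add, LinearMap.add_apply, h₁, h₂, add_zero]
    have : (x : L) ∈ I ⊓ J := ⟨hxI, x.2⟩
    rw [hIJ.inf_eq_bot, LieSubmodule.mem_bot] at this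
    exact Subtype.ext this
  have hB : B.Nondegenerate :=
    ⟨hsep, fun x hx ↦ hsep x fun y ↦ (hBsymm.eq y x).symm.trans (hx y)⟩
  have hJ : 0 < finrank K J.toSubmodule := by
    rw [finrank_pos_iff, Submodule.nontrivial_iff_ne_bot]
    intro hbot
    have hJbot : J = ⊥ := by rwa [← LieSubmodule.toSubmodule_eq_bot]
    have hItop : I = ⊤ := by simpa [hJbot] using hIJ.sup_eq_top
    refine h (LinearMap.ext₂ fun x y ↦ (hI y).mp ?_ x)
    rw [hItop]
    exact LieSubmodule.mem_top y
  let b := finBasis K J.toSubmodule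
  let b' := B.dualBasis hB b
  refine ⟨∑ i, toEnd K L M (b i) * toEnd K L M (b' i), ?_, ?_, ?_⟩
  · refine commute_toEnd_sum_mul J (fun i ↦ (b i : L)) (fun i ↦ (b' i : L)) (fun i ↦ (b i).2)
      (fun i ↦ (b' i).2) ?_ ?_
    · intro x hx
      have := congrArg Subtype.val (b.sum_repr ⟨x, hx⟩)
      have hr (i) : b.repr ⟨x, hx⟩ i = traceForm K L M x (b' i) := by
        have := LinearMap.BilinForm.dualBasis_repr_apply hB b' ⟨x, hx⟩ i
        rwa [LinearMap.BilinForm.dualBasis_dualBasis hB hBsymm] at this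
      simpa [hr] using this.symm
    · intro x hx
      have := congrArg Subtype.val (b'.sum_repr ⟨x, hx⟩)
      have hr (i) : b'.repr ⟨x, hx⟩ i = traceForm K L M x (b i) :=
        LinearMap.BilinForm.dualBasis_repr_apply hB b ⟨x, hx⟩ i
      simpa [hr] using this.symm
  · intro hnil
    -- The trace of the Casimir operator is `dim J`, nonzero in characteristic zero.
    have htr := (isNilpotent_trace_of_isNilpotent hnil).eq_zero
    have hone (i) : trace K M (toEnd K L M (b i) * toEnd K L M (b' i)) = 1 := by
      have := LinearMap.BilinForm.apply_dualBasis_right hB hBsymm b i i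
      rwa [if_pos rfl] at this
    rw [map_sum, Finset.sum_congr rfl fun i _ ↦ hone i] at htr
    simp only [Finset.sum_const, Finset.card_univ, Fintype.card_fin, nsmul_eq_mul, mul_one,
      Nat.cast_eq_zero] at htr
    exact hJ.ne' htr
  · intro m hm
    rw [mem_maxTrivSubmodule] at hm
    simp [hm]

end LieRep

/-- In a representation of a semisimple Lie algebra `L` in characteristic zero, no nonzero
invariant lies in the span of the image of the action. -/
theorem eq_zero_of_mem_maxTrivSubmodule_of_mem_lie_top {K L : Type*} [Field K] [CharZero K]
    [LieRing L] [LieAlgebra K L] [FiniteDimensional K L] [LieAlgebra.HasTrivialRadical K L]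
    {M : Type*} [AddCommGroup M] [Module K M] [LieRingModule L M] [LieModule K L M]
    [FiniteDimensional K M] {v : M} (hv : v ∈ maxTrivSubmodule K L M)
    (hv' : v ∈ ⁅(⊤ : LieIdeal K L), (⊤ : LieSubmodule K L M)⁆) : v = 0 := by
  induction hn : finrank K M using Nat.strong_induction_on generalizing M with
  | _ n ih =>
  subst hn
  by_cases h : traceForm K L M = 0
  · rwa [lie_top_top_eq_bot_of_traceForm_eq_zero h, LieSubmodule.mem_bot] at hv'
  obtain ⟨Ω, hcomm, hnil, hker⟩ := exists_commute_toEnd_not_isNilpotent K L M h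
  -- `1 ≤ k` is needed for `Ω ^ k` to kill `v`.
  obtain ⟨k, hk, hk1⟩ :=
    ((eventually_isCompl_ker_pow_range_pow Ω).and (Filter.eventually_ge_atTop 1)).exists
  have hcomm' (y : L) (m : M) : (Ω ^ k) ⁅y, m⁆ = ⁅y, (Ω ^ k) m⁆ :=
    (LinearMap.congr_fun ((hcomm y).pow_right k).eq m).symm
  let N : LieSubmodule K L M :=
    { (Ω ^ k).ker with
      lie_mem := fun {x m} hm ↦ by
        change (Ω ^ k) ⁅x, m⁆ = 0
        rw [hcomm', show (Ω ^ k) m = 0 from hm, lie_zero] }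
  let R : LieSubmodule K L M :=
    { (Ω ^ k).range with
      lie_mem := fun {x m} hm ↦ by
        obtain ⟨m, rfl⟩ := hm
        exact ⟨⁅x, m⁆, hcomm' x m⟩ }
  have hNR : IsCompl N R := by
    rw [← LieSubmodule.isCompl_toSubmodule]
    exact hk
  have hvN : v ∈ N := by
    change (Ω ^ k) v = 0
    obtain ⟨j, rfl⟩ := Nat.exists_eq_add_of_le' hk1
    rw [pow_succ, Module.End.mul_apply, hker v hv, map_zero]
  have hvlie : v ∈ ⁅(⊤ : LieIdeal K L), N⁆ := by
    rw [← hNR.sup_eq_top, LieSubmodule.lie_sup, LieSubmodule.mem_sup] at hv'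
    obtain ⟨a, ha, c, hc, rfl⟩ := hv'
    have hcN : c ∈ N := by
      have := sub_mem hvN (LieSubmodule.lie_le_right N _ ha)
      rwa [add_sub_cancel_left] at this
    have hc0 : c ∈ N ⊓ R := ⟨hcN, LieSubmodule.lie_le_right R _ hc⟩
    rw [hNR.inf_eq_bot, LieSubmodule.mem_bot] at hc0
    rwa [hc0, add_zero]
  have hlt : finrank K N < finrank K M := by
    refine Submodule.finrank_lt (s := N.toSubmodule) (ne_of_lt (lt_top_iff_ne_top.mpr ?_))
    intro htop
    exact hnil ⟨k, LinearMap.ker_eq_top.mp htop⟩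
  have hmap : LieSubmodule.map N.incl ⁅(⊤ : LieIdeal K L), (⊤ : LieSubmodule K L N)⁆ =
      ⁅(⊤ : LieIdeal K L), N⁆ := by
    rw [LieSubmodule.map_bracket_eq]
    simp
  rw [← hmap, LieSubmodule.mem_map] at hvlie
  obtain ⟨w, hw, rfl⟩ := hvlie
  have hw0 : w = 0 := by
    refine ih _ hlt ?_ hw rfl
    rw [mem_maxTrivSubmodule] at hv ⊢
    exact fun x ↦ Subtype.ext (hv x)
  rw [hw0, map_zero]

end LieModule

/-! ### The Lie algebra of left multiplications -/

namespace LeibnizAlg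

attribute [local instance] LieRing.ofAssociativeRing

variable {F L : Type*} [Field F] [NonUnitalNonAssocRing L] [Module F L] [IsScalarTower F L L]
  [SMulCommClass F L L]

variable (F) in
/-- The Lie algebra of left multiplication operators of a left Leibniz algebra. -/
def leftMulLieSubalgebra (hL : IsLeftLeibniz L) : LieSubalgebra F (Module.End F L) :=
  { (LinearMap.mul F L).range with
    lie_mem' := by
      rintro _ _ ⟨x, rfl⟩ ⟨y, rfl⟩
      refine ⟨x * y, LinearMap.ext fun z ↦ ?_⟩
      rw [LieRing.of_associative_ring_bracket, LinearMap.sub_apply, Module.End.mul_apply,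
        Module.End.mul_apply]
      simp only [LinearMap.mul_apply']
      rw [hL x y z, add_sub_cancel_right] }

variable (F) in
/-- The map sending `x` to left multiplication by `x`. -/
def toLeftMul (hL : IsLeftLeibniz L) : L →ₗ[F] leftMulLieSubalgebra F hL :=
  (LinearMap.mul F L).rangeRestrict

lemma toLeftMul_surjective (hL : IsLeftLeibniz L) : Function.Surjective (toLeftMul F hL) :=
  (LinearMap.mul F L).surjective_rangeRestrict

lemma toLeftMul_lie (hL : IsLeftLeibniz L) (x y : L) : ⁅toLeftMul F hL x, y⁆ = x * y := rfl

lemma toLeftMul_mul (hL : IsLeftLeibniz L) (x y : L) :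
    toLeftMul F hL (x * y) = ⁅toLeftMul F hL x, toLeftMul F hL y⁆ := by
  refine Subtype.ext (LinearMap.ext fun z ↦ ?_)
  change x * y * z = x * (y * z) - y * (x * z)
  rw [hL x y z, add_sub_cancel_right]

lemma mul_eq_zero_of_toLeftMul_eq_zero (hL : IsLeftLeibniz L) {x : L}
    (hx : toLeftMul F hL x = 0) (y : L) : x * y = 0 := by
  rw [← toLeftMul_lie (F := F) hL, hx, zero_lie]

lemma toLeftMul_eq_zero_of_mem_leibnizKernel (hL : IsLeftLeibniz L) {x : L}
    (hx : x ∈ leibnizKernel F L) : toLeftMul F hL x = 0 := by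
  suffices leibnizKernel F L ≤ LinearMap.ker (toLeftMul F hL) from this hx
  refine Submodule.span_le.mpr ?_
  rintro _ ⟨x, rfl⟩
  change toLeftMul F hL (x * x) = 0
  rw [toLeftMul_mul, lie_self]

lemma derivedSeries_comap_le (hL : IsLeftLeibniz L)
    (I : LieIdeal F (leftMulLieSubalgebra F hL)) (n : ℕ) :
    derivedSeries (I.toSubmodule.comap (toLeftMul F hL)) n ≤
      (LieAlgebra.derivedSeriesOfIdeal F _ n I).toSubmodule.comap (toLeftMul F hL) := by
  induction n with
  | zero => exact le_rfl
  | succ n ih =>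
    refine Submodule.span_le.mpr ?_
    rintro _ ⟨a, ha, b, hb, rfl⟩
    change toLeftMul F hL (a * b) ∈ LieAlgebra.derivedSeriesOfIdeal F _ (n + 1) I
    rw [toLeftMul_mul, LieAlgebra.derivedSeriesOfIdeal_succ]
    exact LieSubmodule.lie_mem_lie (ih ha) (ih hb)

/-- In a semisimple Leibniz algebra, the preimage of a solvable ideal of the Lie algebra of left
multiplications is contained in the Leibniz kernel. -/
lemma comap_toLeftMul_le_leibnizKernel (hL : IsLeftLeibniz L) (hss : IsSemisimple F L)
    (I : LieIdeal F (leftMulLieSubalgebra F hL)) [hI : LieAlgebra.IsSolvable I] :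
    I.toSubmodule.comap (toLeftMul F hL) ≤ leibnizKernel F L := by
  refine hss _ ?_ ?_
  · intro x a ha
    constructor
    · change toLeftMul F hL (x * a) ∈ I
      rw [toLeftMul_mul]
      exact lie_mem_right F _ I _ _ ha
    · change toLeftMul F hL (a * x) ∈ I
      rw [toLeftMul_mul]
      exact lie_mem_left F _ I _ _ ha
  · obtain ⟨k, hk⟩ := LieAlgebra.IsSolvable.solvable F I
    rw [LieIdeal.derivedSeries_eq_bot_iff] at hk
    -- Term `k` need not vanish, but its elements have zero left multiplication; one more product
    -- kills it.
    refine ⟨k + 1, ?_⟩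
    rw [eq_bot_iff]
    refine Submodule.span_le.mpr ?_
    rintro _ ⟨a, ha, b, -, rfl⟩
    have ha' : toLeftMul F hL a ∈ LieAlgebra.derivedSeriesOfIdeal F _ k I :=
      derivedSeries_comap_le hL I k ha
    rw [hk, LieSubmodule.mem_bot] at ha'
    exact mul_eq_zero_of_toLeftMul_eq_zero hL ha' b

lemma hasTrivialRadical_leftMulLieSubalgebra (hL : IsLeftLeibniz L) (hss : IsSemisimple F L) :
    LieAlgebra.HasTrivialRadical F (leftMulLieSubalgebra F hL) := by
  refine LieAlgebra.hasTrivialRadical_of_no_solvable_ideals fun I _ ↦ ?_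
  rw [eq_bot_iff]
  intro f hf
  obtain ⟨x, rfl⟩ := toLeftMul_surjective hL f
  exact toLeftMul_eq_zero_of_mem_leibnizKernel hL (comap_toLeftMul_le_leibnizKernel hL hss I hf)

/-- If `x * c = 0` for all `x`, left multiplication by `c` commutes with all the others, so it lies
in the center, a solvable ideal. -/
lemma rightCenter_le_leibnizKernel (hL : IsLeftLeibniz L) (hss : IsSemisimple F L) :
    rightCenter F L ≤ leibnizKernel F L := by
  refine le_trans ?_ (comap_toLeftMul_le_leibnizKernel hL hss (LieAlgebra.center F _))
  intro c hc
  change toLeftMul F hL c ∈ LieAlgebra.center F _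
  rw [LieModule.mem_maxTrivSubmodule]
  intro f
  obtain ⟨x, rfl⟩ := toLeftMul_surjective hL f
  rw [← toLeftMul_mul, hc x, map_zero]

lemma leibnizKernel_le_lie_top (hL : IsLeftLeibniz L) :
    leibnizKernel F L ≤ LieSubmodule.toSubmodule
      ⁅(⊤ : LieIdeal F (leftMulLieSubalgebra F hL)),
        (⊤ : LieSubmodule F (leftMulLieSubalgebra F hL) L)⁆ := by
  refine Submodule.span_le.mpr ?_
  rintro _ ⟨x, rfl⟩
  exact LieSubmodule.lie_mem_lie (LieSubmodule.mem_top (toLeftMul F hL x))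
    (LieSubmodule.mem_top x)

end LeibnizAlg

theorem proposition4p2 {F L : Type*} [Field F] [CharZero F]
    [NonUnitalNonAssocRing L] [Module F L] [IsScalarTower F L L] [SMulCommClass F L L]
    [FiniteDimensional F L]
    (hL : LeibnizAlg.IsLeftLeibniz L) (hss : LeibnizAlg.IsSemisimple F L) :
    LeibnizAlg.rightCenter F L = ⊥ := by
  have := LeibnizAlg.hasTrivialRadical_leftMulLieSubalgebra hL hss
  have hfin : FiniteDimensional F (LeibnizAlg.leftMulLieSubalgebra F hL) :=
    Module.Finite.of_surjective _ (LeibnizAlg.toLeftMul_surjective hL)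
  rw [eq_bot_iff]
  intro c hc
  refine LieModule.eq_zero_of_mem_maxTrivSubmodule_of_mem_lie_top (K := F)
    (L := LeibnizAlg.leftMulLieSubalgebra F hL) ?_ (LeibnizAlg.leibnizKernel_le_lie_top hL
      (LeibnizAlg.rightCenter_le_leibnizKernel hL hss hc))
  rw [LieModule.mem_maxTrivSubmodule]
  intro f
  obtain ⟨x, rfl⟩ := LeibnizAlg.toLeftMul_surjective hL f
  rw [LeibnizAlg.toLeftMul_lie]
  exact hc x
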